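/- Let $\mathbb F_q$ be a finite field with $q$ elements and let $k\ge 1$ be an integer; both are fixed. Call $g\in GL(n,q)$ a derangement on $k$-spaces if $gW\neq W$ for every $k$-dimensional subspace $W$ of $\mathbb F_q^n$. For a nonempty subset $S\subseteq GL(n,q)$ let $d_k(S)$ denote the proportion of elements of $S$ which are derangements on $k$-spaces. Then the limit $$L=\lim_{n\to\infty} d_k(GL(n,q))$$ exists, and for every choice of elements $g_n\in GL(n,q)$ $(n\ge 0)$ the proportions in the cosets $g_nSL(n,q)$ satisfy $$\lim_{n\to\infty} d_k\bigl(g_nSL(n,q)\bigr)=L.$$ -/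

import Mathlib

open Filter Topology
open scoped Pointwise MatrixGroups

/-- `g ∈ GL(n, F)` is a derangement on `k`-spaces: in the natural action of `GL(n, F)` on the
set of `k`-dimensional subspaces of `F ^ n`, no point is fixed by `g`. -/
def IsDerangementOnKSpaces {F : Type*} [Field F] {n : ℕ} (k : ℕ) (g : GL (Fin n) F) : Prop :=
  ∀ W : Submodule F (Fin n → F), Module.finrank F W = k →
    W.map (Matrix.toLin' (g : Matrix (Fin n) (Fin n) F)) ≠ W

/-- The special linear group `SL(n, F)`, as a subgroup of `GL(n, F)`. -/
def slSubgroup (n : ℕ) (F : Type*) [Field F] : Subgroup (GL (Fin n) F) :=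
  (Matrix.SpecialLinearGroup.toGL (n := Fin n) (R := F)).range

/-- The proportion of elements of the (finite, nonempty) set `S` of matrices in `GL(n, F)`
which are derangements on `k`-spaces. -/
noncomputable def derangementProportion {F : Type*} [Field F] {n : ℕ} (k : ℕ)
    (S : Set (GL (Fin n) F)) : ℝ :=
  ({h ∈ S | IsDerangementOnKSpaces k h}.ncard : ℝ) / (S.ncard : ℝ)

/-!
Write `q = |F|`. Whether `g ∈ GL(n, q)` fixes a `k`-space is decided by a piece of `g`. An invariant
`k`-space has a characteristic polynomial of degree `k`, so it lies in the generalized kernel of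
`P(g)`, where `P` is the product of the monic irreducible polynomials of degree at most `k` other
than `X` (`le_ker_pow_of_map_eq`). Call the restriction of `g` to this generalized kernel its
*primary part*, and call `g` *free* if `P(g)` is injective, that is, if the primary part is zero.

*Counting pairs.* Fix an automorphism `C` of a space `W`. An injective map `i : W → V` with
`g ∘ i = i ∘ C` exhibits `g` as a block triangular matrix with blocks `C` and `g'`, so the pairs
`(i, g)` with `det g = δ` and `P(g')` injective can be counted exactly: they are as many as
`|GL(V)| / |GL(B)|` times the free `g' ∈ GL(B)` with `det g' = δ / det C`, where
`dim B = dim V - dim W` (`card_isAdapted_pairs`). If `P(C)` is injective, the condition on `g'`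
says that `g` is free; if `P(C)` is nilpotent, it says that the range of `i` is the generalized
kernel of `P(g)`.

*Free elements.* The proportion of free elements of determinant `δ` in `GL(n, q)` tends to a
positive limit which does not depend on `δ`. This is proved for every product of distinct monic
irreducible polynomials other than `X`, one factor `φ` at a time. With `E = F[X]/(φ)` and
`Q = |E|`, the injective intertwining maps from `E ^ m` to `V` number
`∏_{j < m} (Q ^ k - Q ^ j)`, where `k` is the `E`-dimension of `ker φ(g)`, and `q`-binomial
inversion writes the indicator of `k = 0` as a combination of these numbers with coefficients
`(-1) ^ m / ∏_{1 ≤ i ≤ m} (Q ^ i - 1)`. Counting pairs turns this into `freeProportion_mul_eq`. The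
coefficients are absolutely summable with positive sum, so dominated convergence gives the limit;
in it the shift of the determinant by `det C` has disappeared.

*All elements.* Sorting by the primary part `C` writes the proportion of derangements of
determinant `δ` as a sum over `C` of free proportions in dimension `n - a` and determinant
`δ / det C`, with weights `1 / |GL(a, q)|` (`proportion_eq_sum_primaryElement`). The same identity
for *all* elements of determinant `δ` has sums at most `1`; as the free proportions have a positive
limit, the weights are summable (`summable_card_primaryElement_div`), and dominated convergence
applies once more. The limit `l` is the same for every `δ`. A coset of `SL(n, q)` is a fibre of the
determinant, and `GL(n, q)` is the union of these `q - 1` fibres, so both limits are `(q - 1) l`.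
-/

open Module Polynomial

/-! ### Adapted pairs -/

section Intertwining

variable {F V W : Type*} [Field F] [AddCommGroup V] [Module F V] [AddCommGroup W] [Module F W]

/-- A linear map that intertwines `g` and `g'` intertwines `P(g)` and `P(g')`. -/
theorem aeval_apply_of_semiconj {f : V →ₗ[F] W} {g : End F V} {g' : End F W}
    (h : ∀ v, f (g v) = g' (f v)) (P : F[X]) (v : V) :
    f (aeval g P v) = aeval g' P (f v) := by
  induction P using Polynomial.induction_on' generalizing v with
  | add p q hp hq => simp [hp, hq]
  | monomial n a =>
    have key : ∀ n v, f ((g ^ n) v) = (g' ^ n) (f v) := by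
      intro n
      induction n with
      | zero => simp
      | succ n ih => intro v; rw [pow_succ, pow_succ, Module.End.mul_apply, ih, h]; rfl
    simp [aeval_monomial, key, Module.algebraMap_end_apply]

end Intertwining

section Block

variable {F V W B : Type*} [Field F] [AddCommGroup V] [Module F V] [AddCommGroup W] [Module F W]
  [AddCommGroup B] [Module F B] [FiniteDimensional F V] [FiniteDimensional F W]
  [FiniteDimensional F B]

theorem LinearEquiv.det_skewProd (e : B ≃ₗ[F] B) (C : W ≃ₗ[F] W) (f : B →ₗ[F] W) :
    LinearEquiv.det (e.skewProd C f) = LinearEquiv.det e * LinearEquiv.det C := by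
  ext
  rw [LinearEquiv.coe_det, Units.val_mul, LinearEquiv.coe_det, LinearEquiv.coe_det]
  let b := Module.Free.chooseBasis F B
  let b' := Module.Free.chooseBasis F W
  have key : LinearMap.toMatrix (b.prod b') (b.prod b') (e.skewProd C f : B × W →ₗ[F] B × W) =
      Matrix.fromBlocks (LinearMap.toMatrix b b e) 0 (LinearMap.toMatrix b b' f)
        (LinearMap.toMatrix b' b' C) := by
    ext (i | i) (j | j) <;> simp [LinearMap.toMatrix_apply]
  rw [← LinearMap.det_toMatrix (b.prod b'), key, Matrix.det_fromBlocks_zero₁₂,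
    LinearMap.det_toMatrix, LinearMap.det_toMatrix]

/-- The automorphisms of `B × W` that restrict to `C` on `W` are the block triangular ones. -/
noncomputable def skewProdEquiv (C : W ≃ₗ[F] W) :
    (B ≃ₗ[F] B) × (B →ₗ[F] W) ≃
      {g : (B × W) ≃ₗ[F] (B × W) // ∀ w, g (0, w) = (0, C w)} :=
  Equiv.ofBijective (fun p => ⟨p.1.skewProd C p.2, fun w => by simp⟩) <| by
    constructor
    · rintro ⟨e, f⟩ ⟨e', f'⟩ h
      have h' : ∀ b, e.skewProd C f (b, 0) = e'.skewProd C f' (b, 0) := fun b => by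
        rw [Subtype.mk.injEq] at h
        rw [h]
      simp only [LinearEquiv.skewProd_apply, map_zero, zero_add, Prod.mk.injEq] at h'
      exact Prod.ext (LinearEquiv.ext fun b => (h' b).1) (LinearMap.ext fun b => (h' b).2)
    · rintro ⟨g, hg⟩
      -- The diagonal block on `B` is injective because `g` maps `0 × W` onto itself.
      let e₀ : B →ₗ[F] B := LinearMap.fst F B W ∘ₗ (g : B × W →ₗ[F] B × W) ∘ₗ LinearMap.inl F B W
      have he₀ : Function.Injective e₀ := by
        rw [injective_iff_map_eq_zero]
        intro b hb
        have h1 : g (b, 0) = g (0, C.symm (g (b, 0)).2) := by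
          rw [hg, C.apply_symm_apply]
          exact Prod.ext hb rfl
        exact congrArg Prod.fst (g.injective h1)
      refine ⟨⟨LinearEquiv.ofInjectiveEndo e₀ he₀,
        LinearMap.snd F B W ∘ₗ (g : B × W →ₗ[F] B × W) ∘ₗ LinearMap.inl F B W⟩, ?_⟩
      apply Subtype.ext
      apply LinearEquiv.ext
      rintro ⟨b, w⟩
      have h2 : g (b, w) = g (b, 0) + g (0, w) := by rw [← map_add]; simp
      rw [h2, hg]
      ext <;> simp [e₀, add_comm]

omit [FiniteDimensional F W] in
theorem skewProdEquiv_apply (C : W ≃ₗ[F] W) (p : (B ≃ₗ[F] B) × (B →ₗ[F] W)) :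
    (skewProdEquiv C p : (B × W) ≃ₗ[F] (B × W)) = p.1.skewProd C p.2 := rfl

omit [FiniteDimensional F W] in
theorem exists_linearEquiv_extending {i : W →ₗ[F] V} (hi : Function.Injective i)
    (hV : finrank F V = finrank F B + finrank F W) :
    ∃ x : (B × W) ≃ₗ[F] V, ∀ w, x (0, w) = i w := by
  obtain ⟨K, hK⟩ := Submodule.exists_isCompl (LinearMap.range i)
  have h1 := Submodule.finrank_add_eq_of_isCompl hK
  rw [LinearMap.finrank_range_of_inj hi] at h1
  let e : B ≃ₗ[F] K := LinearEquiv.ofFinrankEq B K (by omega)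
  refine ⟨(e.prodCongr (LinearEquiv.ofInjective i hi)).trans
    (Submodule.prodEquivOfIsCompl _ _ hK.symm), fun w => ?_⟩
  simp

/-- The pair `(i, g)` is adapted to `C`: the automorphism `g` has determinant `δ`, restricts to `C`
along `i : W → V`, and `P(g)` is injective on the cokernel of `i`. The last condition is expressed
without forming the quotient. -/
def IsAdapted (P : F[X]) (δ : Fˣ) (C : W ≃ₗ[F] W) (i : W →ₗ[F] V) (g : V ≃ₗ[F] V) : Prop :=
  (∀ w, g (i w) = i (C w)) ∧ LinearEquiv.det g = δ ∧
    ∀ v, aeval (g : End F V) P v ∈ LinearMap.range i → v ∈ LinearMap.range i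

/-- The number of automorphisms `g` of `V` with determinant `δ` such that `P(g)` is injective. -/
noncomputable def freeCount (V : Type*) [AddCommGroup V] [Module F V] (P : F[X]) (δ : Fˣ) : ℕ :=
  Nat.card {g : V ≃ₗ[F] V // LinearEquiv.det g = δ ∧ Function.Injective (aeval (g : End F V) P)}

theorem isAdapted_inr_skewProd_iff (P : F[X]) (δ : Fˣ) (C : W ≃ₗ[F] W) (e : B ≃ₗ[F] B)
    (f : B →ₗ[F] W) :
    IsAdapted P δ C (LinearMap.inr F B W) (e.skewProd C f) ↔
      LinearEquiv.det e = δ * (LinearEquiv.det C)⁻¹ ∧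
        Function.Injective (aeval (e : End F B) P) := by
  have h1 : ∀ v, (aeval (e.skewProd C f : End F (B × W)) P v).1 = aeval (e : End F B) P v.1 :=
    fun v => aeval_apply_of_semiconj (f := LinearMap.fst F B W) (by simp) P v
  rw [IsAdapted, LinearEquiv.det_skewProd, ← eq_mul_inv_iff_mul_eq, injective_iff_map_eq_zero]
  have h2 : ∀ v : B × W, v ∈ LinearMap.range (LinearMap.inr F B W) ↔ v.1 = 0 := by
    rintro ⟨b, w⟩
    simp [eq_comm]
  simp only [h2, h1]
  constructor
  · rintro ⟨-, h, h'⟩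
    exact ⟨h, fun b hb => h' (b, 0) hb⟩
  · rintro ⟨h, h'⟩
    exact ⟨fun w => by simp, h, fun v hv => h' _ hv⟩

omit [FiniteDimensional F V] [FiniteDimensional F W] in
theorem isAdapted_conj_iff (P : F[X]) (δ : Fˣ) (C : W ≃ₗ[F] W) {U : Type*} [AddCommGroup U]
    [Module F U] (j : W →ₗ[F] U) (i : W →ₗ[F] V) (x : U ≃ₗ[F] V) (hx : ∀ w, x (j w) = i w)
    (g : U ≃ₗ[F] U) :
    IsAdapted P δ C i (x.symm.trans (g.trans x)) ↔ IsAdapted P δ C j g := by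
  have h1 : ∀ u, x (aeval (g : End F U) P u) =
      aeval ((x.symm.trans (g.trans x) : V ≃ₗ[F] V) : End F V) P (x u) :=
    fun u => aeval_apply_of_semiconj (f := (x : U →ₗ[F] V)) (by simp) P u
  have h2 : ∀ u, x u ∈ LinearMap.range i ↔ u ∈ LinearMap.range j := by
    intro u
    simp [← hx]
  rw [IsAdapted, IsAdapted]
  refine and_congr ?_ (and_congr ?_ ?_)
  · simp [← hx]
  · have h3 : x.symm.trans (g.trans x) = (x.symm.trans g).trans x := rfl
    rw [h3, LinearEquiv.det_conj]
  · rw [← x.toEquiv.forall_congr_right]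
    refine forall_congr' fun u => ?_
    rw [← h2, ← h2, h1]
    rfl

/-- An injective map `i` extends to an isomorphism `B × W ≃ V`, which carries the automorphisms
adapted to `i` to block triangular ones. -/
theorem card_isAdapted (P : F[X]) (δ : Fˣ) (C : W ≃ₗ[F] W) {i : W →ₗ[F] V}
    (hi : Function.Injective i) (hV : finrank F V = finrank F B + finrank F W) :
    Nat.card {g : V ≃ₗ[F] V // IsAdapted P δ C i g} =
      freeCount B P (δ * (LinearEquiv.det C)⁻¹) * Nat.card (B →ₗ[F] W) := by
  obtain ⟨x, hx⟩ := exists_linearEquiv_extending (B := B) hi hV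
  let conj : ((B × W) ≃ₗ[F] (B × W)) ≃ (V ≃ₗ[F] V) :=
    { toFun := fun g => x.symm.trans (g.trans x)
      invFun := fun g => x.trans (g.trans x.symm)
      left_inv := fun g => by ext <;> simp
      right_inv := fun g => by ext; simp }
  rw [freeCount, ← Nat.card_prod]
  apply Nat.card_congr
  calc {g : V ≃ₗ[F] V // IsAdapted P δ C i g}
      ≃ {g : (B × W) ≃ₗ[F] (B × W) // IsAdapted P δ C (LinearMap.inr F B W) g} :=
        (conj.subtypeEquiv fun g => (isAdapted_conj_iff P δ C _ i x hx g).symm).symm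
    _ ≃ {g : {g : (B × W) ≃ₗ[F] (B × W) // ∀ w, g (0, w) = (0, C w)} //
          IsAdapted P δ C (LinearMap.inr F B W) g} :=
        (Equiv.subtypeSubtypeEquivSubtype fun {g} hg => hg.1).symm
    _ ≃ {p : (B ≃ₗ[F] B) × (B →ₗ[F] W) // LinearEquiv.det p.1 = δ * (LinearEquiv.det C)⁻¹ ∧
          Function.Injective (aeval (p.1 : End F B) P)} :=
        ((skewProdEquiv C).subtypeEquiv fun p => by
          rw [skewProdEquiv_apply, isAdapted_inr_skewProd_iff]).symm
    _ ≃ _ :=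
        { toFun := fun p => (⟨p.1.1, p.2⟩, p.1.2)
          invFun := fun p => ⟨(p.1.1, p.2), p.1.2⟩
          left_inv := fun p => rfl
          right_inv := fun p => rfl }

omit [FiniteDimensional F W] in
theorem card_linearEquiv_extending {i : W →ₗ[F] V}
    (hi : Function.Injective i) (hV : finrank F V = finrank F B + finrank F W) :
    Nat.card {x : (B × W) ≃ₗ[F] V // ∀ w, x (0, w) = i w} =
      Nat.card (B ≃ₗ[F] B) * Nat.card (B →ₗ[F] W) := by
  obtain ⟨x, hx⟩ := exists_linearEquiv_extending (B := B) hi hV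
  rw [← Nat.card_prod, Nat.card_congr (skewProdEquiv (LinearEquiv.refl F W))]
  let t : ((B × W) ≃ₗ[F] (B × W)) ≃ ((B × W) ≃ₗ[F] V) :=
    { toFun := fun g => g.trans x
      invFun := fun y => y.trans x.symm
      left_inv := fun g => by ext <;> simp
      right_inv := fun g => by ext; simp }
  refine (Nat.card_congr (t.subtypeEquiv fun g => ?_)).symm
  simp [t, ← hx]

variable [Finite F]

instance finite_linearMap : Finite (V →ₗ[F] W) :=
  have := Module.finite_of_finite F (M := V)
  have := Module.finite_of_finite F (M := W)
  Finite.of_injective (fun f : V →ₗ[F] W => (f : V → W)) DFunLike.coe_injective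

instance finite_linearEquiv : Finite (V ≃ₗ[F] W) :=
  Finite.of_injective (fun f : V ≃ₗ[F] W => (f : V →ₗ[F] W)) LinearEquiv.toLinearMap_injective

/-- Every injective map `W → V` is the restriction of equally many isomorphisms `B × W ≃ V`. -/
theorem card_injective_mul (hV : finrank F V = finrank F B + finrank F W) :
    Nat.card {i : W →ₗ[F] V // Function.Injective i} *
      (Nat.card (B ≃ₗ[F] B) * Nat.card (B →ₗ[F] W)) = Nat.card (V ≃ₗ[F] V) := by
  have := Fintype.ofFinite {i : W →ₗ[F] V // Function.Injective i}
  let e : (B × W) ≃ₗ[F] V := LinearEquiv.ofFinrankEq _ _ (by simp [hV])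
  have h1 : Nat.card (V ≃ₗ[F] V) = Nat.card ((B × W) ≃ₗ[F] V) :=
    Nat.card_congr
      { toFun := fun g => e.trans g
        invFun := fun y => e.symm.trans y
        left_inv := fun g => by ext; simp
        right_inv := fun g => by ext; simp }
  let r : ((B × W) ≃ₗ[F] V) → {i : W →ₗ[F] V // Function.Injective i} := fun x =>
    ⟨(x : B × W →ₗ[F] V) ∘ₗ LinearMap.inr F B W,
      x.injective.comp LinearMap.inr_injective⟩
  rw [h1, ← Nat.card_congr (Equiv.sigmaFiberEquiv r), Nat.card_sigma]
  have h2 : ∀ i, Nat.card {x // r x = i} = Nat.card (B ≃ₗ[F] B) * Nat.card (B →ₗ[F] W) := by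
    rintro ⟨i, hi⟩
    rw [← card_linearEquiv_extending hi hV]
    refine Nat.card_congr (Equiv.subtypeEquivRight fun x => ?_)
    simp [r, LinearMap.ext_iff]
  simp [h2]

/-- The number of adapted pairs. The off-diagonal block contributes a factor `|Hom(B, W)|` both to
the automorphisms adapted to a given `i` and to the isomorphisms extending it, so it cancels. -/
theorem card_isAdapted_pairs (P : F[X]) (δ : Fˣ) (C : W ≃ₗ[F] W)
    (hV : finrank F V = finrank F B + finrank F W) :
    Nat.card {p : {i : W →ₗ[F] V // Function.Injective i} × (V ≃ₗ[F] V) //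
      IsAdapted P δ C p.1.1 p.2} * Nat.card (B ≃ₗ[F] B) =
      Nat.card (V ≃ₗ[F] V) * freeCount B P (δ * (LinearEquiv.det C)⁻¹) := by
  have := Fintype.ofFinite {i : W →ₗ[F] V // Function.Injective i}
  have h1 : Nat.card {p : {i : W →ₗ[F] V // Function.Injective i} × (V ≃ₗ[F] V) //
      IsAdapted P δ C p.1.1 p.2} = Nat.card {i : W →ₗ[F] V // Function.Injective i} *
        (freeCount B P (δ * (LinearEquiv.det C)⁻¹) * Nat.card (B →ₗ[F] W)) := by
    rw [Nat.card_congr (Equiv.subtypeProdEquivSigmaSubtype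
      fun (i : {i : W →ₗ[F] V // Function.Injective i}) g => IsAdapted P δ C i.1 g),
      Nat.card_sigma]
    simp [fun i : {i : W →ₗ[F] V // Function.Injective i} =>
      card_isAdapted (B := B) P δ C i.2 hV]
  rw [h1, ← card_injective_mul (V := V) (W := W) (B := B) hV]
  ring

end Block

section Adapted

variable {F V W : Type*} [Field F] [AddCommGroup V] [Module F V] [AddCommGroup W] [Module F W]
  [FiniteDimensional F V] [FiniteDimensional F W]

omit [FiniteDimensional F V] in
theorem isAdapted_iff_of_injective {P : F[X]} {δ : Fˣ} {C : W ≃ₗ[F] W} {i : W →ₗ[F] V}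
    (hi : Function.Injective i) {g : V ≃ₗ[F] V}
    (hC : Function.Injective (aeval (C : End F W) P)) :
    IsAdapted P δ C i g ↔ (∀ w, g (i w) = i (C w)) ∧ LinearEquiv.det g = δ ∧
      Function.Injective (aeval (g : End F V) P) := by
  refine and_congr_right fun h => and_congr_right fun _ => ?_
  have h1 : ∀ w, i (aeval (C : End F W) P w) = aeval (g : End F V) P (i w) :=
    fun w => aeval_apply_of_semiconj (fun w => (h w).symm) P w
  constructor
  · intro h2
    rw [injective_iff_map_eq_zero]
    intro v hv
    obtain ⟨w, rfl⟩ := h2 v (hv ▸ zero_mem _)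
    rw [← h1, map_eq_zero_iff _ hi, map_eq_zero_iff _ hC] at hv
    rw [hv, map_zero]
  · rintro h2 v ⟨w, hw⟩
    obtain ⟨w', rfl⟩ := LinearMap.surjective_of_injective hC w
    exact ⟨w', h2 (by rw [← h1, hw])⟩

omit [FiniteDimensional F W] in
theorem isAdapted_iff_of_isNilpotent {P : F[X]} {δ : Fˣ} {C : W ≃ₗ[F] W} {i : W →ₗ[F] V}
    {g : V ≃ₗ[F] V} (hC : IsNilpotent (aeval (C : End F W) P)) :
    IsAdapted P δ C i g ↔ (∀ w, g (i w) = i (C w)) ∧ LinearEquiv.det g = δ ∧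
      LinearMap.range i = LinearMap.ker (aeval (g : End F V) P ^ finrank F V) := by
  refine and_congr_right fun h => and_congr_right fun _ => ?_
  have hpow : ∀ (f : End F V) (j : ℕ) (v), (f ^ (j + 1)) v = (f ^ j) (f v) := fun f j v => by
    rw [pow_succ, Module.End.mul_apply]
  constructor
  · intro h2
    apply le_antisymm
    · obtain ⟨N, hN⟩ := hC
      rintro _ ⟨w, rfl⟩
      apply Module.End.ker_pow_le_ker_pow_finrank _ N
      rw [LinearMap.mem_ker, ← map_pow,
        ← aeval_apply_of_semiconj (f := i) (fun w => (h w).symm) (P ^ N) w, map_pow, hN]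
      simp
    · have h3 : ∀ (j : ℕ) (v), (aeval (g : End F V) P ^ j) v = 0 → v ∈ LinearMap.range i := by
        intro j
        induction j with
        | zero => intro v hv; rw [pow_zero, Module.End.one_apply] at hv; simp [hv]
        | succ j ih => intro v hv; exact h2 v (ih _ (by rw [← hpow, hv]))
      exact fun v hv => h3 _ v hv
  · intro h2 v hv
    rw [h2] at hv ⊢
    rw [LinearMap.mem_ker, ← hpow] at hv
    exact Module.End.ker_pow_le_ker_pow_finrank _ _ hv

end Adapted

/-! ### Intertwining maps from a power of `F[X]/(φ)` -/

section Intertwiners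

variable {F V : Type*} [Field F] [AddCommGroup V] [Module F V] [FiniteDimensional F V]

/-- The kernel of `φ(g)` is a vector space over `F[X]/(φ)`, and injective intertwining maps from
`(F[X]/(φ))^m` to `V` are the same as linearly independent `m`-tuples in it. For `m > k` the product
vanishes, as it should. -/
theorem exists_card_intertwining_eq [Finite F] (φ : F[X]) [hφ : Fact (Irreducible φ)]
    (g : End F V) :
    ∃ k ≤ finrank F V, (k = 0 ↔ Function.Injective (aeval g φ)) ∧ ∀ m : ℕ,
      (Nat.card {i : (Fin m → AdjoinRoot φ) →ₗ[F] V // Function.Injective i ∧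
        ∀ w, g (i w) = i (AdjoinRoot.root φ • w)} : ℝ) =
      ∏ j ∈ Finset.range m,
        ((Nat.card (AdjoinRoot φ) : ℝ) ^ k - (Nat.card (AdjoinRoot φ) : ℝ) ^ j) := by
  classical
  have hφ0 : φ ≠ 0 := hφ.out.ne_zero
  have hfd : FiniteDimensional F (AdjoinRoot φ) := (AdjoinRoot.powerBasis hφ0).finite
  have hfin : Finite (AdjoinRoot φ) := Module.finite_of_finite F
  set K := LinearMap.ker (aeval g φ) with hK
  have hgK : ∀ v ∈ K, g v ∈ K := by
    intro v hv
    rw [hK, LinearMap.mem_ker] at hv ⊢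
    rw [← aeval_apply_of_semiconj (f := g) (g := g) (fun _ => rfl) φ v, hv, map_zero]
  let gK : End F K := g.restrict hgK
  have hsub : ∀ (P : F[X]) (x : K), ((aeval gK P x : K) : V) = aeval g P x := fun P x =>
    aeval_apply_of_semiconj (f := K.subtype) (fun v => rfl) P x
  have hgK0 : aeval gK φ = 0 := by
    ext x
    rw [hsub]
    exact x.2
  -- The action of `F[X]/(φ)` on `K = ker φ(g)`, the root of `φ` acting as `g`.
  let ρ : AdjoinRoot φ →+* End F K := Ideal.Quotient.lift (Ideal.span {φ})
    (aeval gK : F[X] →ₐ[F] End F K).toRingHom fun P hP => by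
      obtain ⟨Q, rfl⟩ := Ideal.mem_span_singleton.1 hP
      simp [hgK0]
  have hρ : ∀ P : F[X], ρ (AdjoinRoot.mk φ P) = aeval gK P := fun P => rfl
  let : Module (AdjoinRoot φ) K := Module.compHom K ρ
  have hsmul : ∀ (P : F[X]) (x : K), AdjoinRoot.mk φ P • x = aeval gK P x := fun P x => by
    rw [← hρ]; rfl
  have hroot : ∀ x : K, AdjoinRoot.root φ • x = gK x := fun x => by
    rw [← AdjoinRoot.mk_X, hsmul, aeval_X]
  have : IsScalarTower F (AdjoinRoot φ) K := ⟨fun a e x => by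
    obtain ⟨P, rfl⟩ := AdjoinRoot.mk_surjective e
    rw [AdjoinRoot.smul_mk, hsmul, hsmul, map_smul]
    rfl⟩
  have : FiniteDimensional (AdjoinRoot φ) K := FiniteDimensional.right F (AdjoinRoot φ) K
  have hdim := Module.finrank_mul_finrank F (AdjoinRoot φ) K
  have hpos : 0 < finrank F (AdjoinRoot φ) := finrank_pos
  refine ⟨finrank (AdjoinRoot φ) K, ?_, ?_, fun m => ?_⟩
  · calc finrank (AdjoinRoot φ) K ≤ finrank F (AdjoinRoot φ) * finrank (AdjoinRoot φ) K :=
          Nat.le_mul_of_pos_left _ hpos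
      _ = finrank F K := hdim
      _ ≤ finrank F V := Submodule.finrank_le K
  · rw [← LinearMap.ker_eq_bot, ← hK, ← Submodule.finrank_eq_zero (R := F), ← hdim]
    simp [hpos.ne']
  have hlin : ∀ (i : (Fin m → AdjoinRoot φ) →ₗ[F] V), (∀ w, g (i w) = i (AdjoinRoot.root φ • w)) →
      ∀ (P : F[X]) w, i (AdjoinRoot.mk φ P • w) = aeval g P (i w) := by
    intro i hi P w
    let r : End F (Fin m → AdjoinRoot φ) := Algebra.lsmul F F _ (AdjoinRoot.root φ)
    rw [← aeval_apply_of_semiconj (f := i) (g := r) (fun w => (hi w).symm) P w]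
    rw [aeval_algHom_apply, AdjoinRoot.aeval_eq]
    rfl
  have hmem : ∀ (i : (Fin m → AdjoinRoot φ) →ₗ[F] V), (∀ w, g (i w) = i (AdjoinRoot.root φ • w)) →
      ∀ w, i w ∈ K := by
    intro i hi w
    rw [hK, LinearMap.mem_ker, ← hlin i hi, AdjoinRoot.mk_self, zero_smul, map_zero]
  -- The range of an intertwining map lies in `K`, and over `F[X]/(φ)` such a map is just linear.
  let e : {i : (Fin m → AdjoinRoot φ) →ₗ[F] V // Function.Injective i ∧
      ∀ w, g (i w) = i (AdjoinRoot.root φ • w)} ≃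
      {f : (Fin m → AdjoinRoot φ) →ₗ[AdjoinRoot φ] K // Function.Injective f} :=
    { toFun := fun i => ⟨{ toFun := fun w => ⟨i.1 w, hmem i.1 i.2.2 w⟩
                           map_add' := fun x y => Subtype.ext (map_add i.1 x y)
                           map_smul' := fun a x => by
                            obtain ⟨P, rfl⟩ := AdjoinRoot.mk_surjective a
                            apply Subtype.ext
                            rw [RingHom.id_apply, hsmul, hsub]
                            exact hlin i.1 i.2.2 P x },
          fun x y hxy => i.2.1 (congrArg Subtype.val hxy)⟩
      invFun := fun f => ⟨K.subtype ∘ₗ f.1.restrictScalars F,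
        K.subtype_injective.comp f.2, fun w => by
          have := hroot (f.1 w)
          simp only [LinearMap.comp_apply, LinearMap.restrictScalars_apply, map_smul, this]
          rfl⟩
      left_inv := fun i => rfl
      right_inv := fun f => rfl }
  have e' : {f : (Fin m → AdjoinRoot φ) →ₗ[AdjoinRoot φ] K // Function.Injective f} ≃
      {s : Fin m → K // LinearIndependent (AdjoinRoot φ) s} :=
    ((Pi.basisFun (AdjoinRoot φ) (Fin m)).constr (AdjoinRoot φ)).symm.toEquiv.subtypeEquiv
      fun f => by
        rw [linearIndependent_iff_injective_fintypeLinearCombination]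
        have : Fintype.linearCombination (AdjoinRoot φ)
            (((Pi.basisFun (AdjoinRoot φ) (Fin m)).constr (AdjoinRoot φ)).symm.toEquiv f) = f := by
          apply (Pi.basisFun (AdjoinRoot φ) (Fin m)).ext
          intro j
          simp [Fintype.linearCombination_apply_single, Basis.constr]
        rw [this]
  rw [Nat.card_congr (e.trans e')]
  have := Fintype.ofFinite (AdjoinRoot φ)
  have : Finite K := Module.finite_of_finite F
  rcases le_or_gt m (finrank (AdjoinRoot φ) K) with h | h
  · rw [card_linearIndependent h, Nat.cast_prod, Nat.card_eq_fintype_card,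
      ← Fin.prod_univ_eq_prod_range (fun j => ((Fintype.card (AdjoinRoot φ) : ℝ) ^
        finrank (AdjoinRoot φ) K - (Fintype.card (AdjoinRoot φ) : ℝ) ^ j))]
    refine Finset.prod_congr rfl fun j _ => ?_
    rw [Nat.cast_sub (Nat.pow_le_pow_right Fintype.card_pos (by omega))]
    simp
  · rw [Finset.prod_eq_zero (Finset.mem_range.2 h) (sub_self _)]
    have : IsEmpty {s : Fin m → K // LinearIndependent (AdjoinRoot φ) s} :=
      ⟨fun s => h.not_ge (by simpa using s.2.fintype_card_le_finrank)⟩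
    simp

end Intertwiners

/-! ### `q`-binomial inversion -/

/-- The coefficients of the `q`-binomial inversion: `∑ m, c m * N m` is the indicator of `k = 0`
when `N m` is the number of linearly independent `m`-tuples in a `k`-dimensional space over a
field of `Q` elements. -/
noncomputable def invCoeff (Q : ℝ) (m : ℕ) : ℝ :=
  (-1) ^ m / ∏ i ∈ Finset.range m, (Q ^ (i + 1) - 1)

section

variable {Q : ℝ}

theorem pow_succ_sub_one_pos (hQ : 1 < Q) (i : ℕ) : 0 < Q ^ (i + 1) - 1 :=
  sub_pos.2 (one_lt_pow₀ hQ (Nat.succ_ne_zero i))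

theorem prod_pow_succ_sub_one_pos (hQ : 1 < Q) (m : ℕ) :
    0 < ∏ i ∈ Finset.range m, (Q ^ (i + 1) - 1) :=
  Finset.prod_pos fun i _ => pow_succ_sub_one_pos hQ i

/-- The partial sums have a closed form, with a factor that vanishes when `1 ≤ k ≤ M`. -/
theorem sum_range_invCoeff_mul (hQ : 1 < Q) (k M : ℕ) :
    ∑ m ∈ Finset.range (M + 1), invCoeff Q m * ∏ j ∈ Finset.range m, (Q ^ k - Q ^ j) =
      invCoeff Q M * ∏ j ∈ Finset.range M, (Q ^ k - Q ^ (j + 1)) := by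
  induction M with
  | zero => simp
  | succ M ih =>
    have h1 := (prod_pow_succ_sub_one_pos hQ M).ne'
    have h2 := (pow_succ_sub_one_pos hQ M).ne'
    rw [Finset.sum_range_succ, ih, Finset.prod_range_succ' _ M, Finset.prod_range_succ _ M,
      invCoeff, invCoeff, Finset.prod_range_succ]
    field_simp
    ring

theorem sum_invCoeff_mul (hQ : 1 < Q) {k M : ℕ} (hk : k ≤ M) :
    ∑ m ∈ Finset.range (M + 1), invCoeff Q m * ∏ j ∈ Finset.range m, (Q ^ k - Q ^ j) =
      if k = 0 then 1 else 0 := by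
  split_ifs with h
  · subst h
    rw [Finset.sum_range_succ', Finset.sum_eq_zero]
    · simp [invCoeff]
    · intro m _
      rw [Finset.prod_eq_zero (i := 0) (by simp) (by simp), mul_zero]
  · rw [sum_range_invCoeff_mul hQ]
    obtain ⟨j, rfl⟩ := Nat.exists_eq_succ_of_ne_zero h
    rw [Finset.prod_eq_zero (i := j) (by simpa using hk) (sub_self _), mul_zero]

theorem summable_abs_invCoeff (hQ : 2 ≤ Q) : Summable fun m => |invCoeff Q m| := by
  have hQ1 : 1 < Q := by linarith
  have habs : ∀ m, |invCoeff Q m| = (∏ i ∈ Finset.range m, (Q ^ (i + 1) - 1))⁻¹ := fun m => by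
    rw [invCoeff, abs_div, abs_pow, abs_neg, abs_one, one_pow,
      abs_of_pos (prod_pow_succ_sub_one_pos hQ1 m), one_div]
  refine summable_of_ratio_norm_eventually_le (r := 1 / 2) (by norm_num) ?_
  filter_upwards [eventually_ge_atTop 1] with m hm
  simp only [habs, Real.norm_eq_abs]
  have h0 := prod_pow_succ_sub_one_pos hQ1 m
  rw [abs_of_pos (inv_pos.2 (prod_pow_succ_sub_one_pos hQ1 _)), abs_of_pos (inv_pos.2 h0),
    Finset.prod_range_succ, mul_inv, mul_comm]
  refine mul_le_mul_of_nonneg_right ?_ (inv_pos.2 h0).le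
  rw [one_div]
  apply inv_anti₀ two_pos
  have : Q ^ 2 ≤ Q ^ (m + 1) := pow_le_pow_right₀ hQ1.le (by omega)
  nlinarith

/-- The series is alternating with decreasing terms, so its sum is at least a partial sum of even
length. -/
theorem tsum_invCoeff_pos (hQ : 2 ≤ Q) : 0 < ∑' m, invCoeff Q m := by
  have hQ1 : 1 < Q := by linarith
  have hs : Summable (invCoeff Q) := (summable_abs_invCoeff hQ).of_abs
  set f : ℕ → ℝ := fun m => (∏ i ∈ Finset.range m, (Q ^ (i + 1) - 1))⁻¹ with hf
  have hc : ∀ m, invCoeff Q m = (-1) ^ m * f m := fun m => by rw [invCoeff, div_eq_mul_inv]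
  have hanti : Antitone f := by
    apply antitone_nat_of_succ_le
    intro m
    have h0 := prod_pow_succ_sub_one_pos hQ1 m
    simp only [hf]
    apply inv_anti₀ h0
    rw [Finset.prod_range_succ]
    have : Q ^ 1 ≤ Q ^ (m + 1) := pow_le_pow_right₀ hQ1.le (by omega)
    nlinarith
  have ht := hs.hasSum.tendsto_sum_nat
  simp only [hc] at ht
  -- Four terms are needed: for `Q = 2` the first two cancel.
  have h4 := hanti.alternating_series_le_tendsto ht 2
  simp only [← hc] at h4
  refine lt_of_lt_of_le ?_ h4
  have h1 : 1 ≤ Q - 1 := by linarith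
  have h2 : 3 ≤ Q ^ 2 - 1 := by nlinarith
  have h3 : 1 < Q ^ 3 - 1 := by nlinarith
  have e : ∑ i ∈ Finset.range (2 * 2), (-1) ^ i * f i =
      (1 - (Q - 1)⁻¹) + (Q - 1)⁻¹ * (Q ^ 2 - 1)⁻¹ * (1 - (Q ^ 3 - 1)⁻¹) := by
    simp only [hf, Finset.sum_range_succ, Finset.prod_range_succ, Finset.range_zero,
      Finset.sum_empty, Finset.prod_empty]
    norm_num
    ring
  rw [Finset.sum_congr rfl fun i _ => hc i, e]
  have h1' : (Q - 1)⁻¹ ≤ 1 := inv_le_one_of_one_le₀ h1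
  have h3' : (Q ^ 3 - 1)⁻¹ < 1 := inv_lt_one_of_one_lt₀ h3
  have : 0 < (Q - 1)⁻¹ * (Q ^ 2 - 1)⁻¹ * (1 - (Q ^ 3 - 1)⁻¹) := by
    have := sub_pos.2 h3'
    positivity
  linarith

end

/-! ### Proportions of free elements -/

section FreeProportion

variable {F : Type*} [Field F]

/-- The proportion of `g ∈ GL(n, F)` such that `g` has determinant `δ` and `P(g)` is injective. -/
noncomputable def freeProportion (P : F[X]) (n : ℕ) (δ : Fˣ) : ℝ :=
  freeCount (Fin n → F) P δ / Nat.card ((Fin n → F) ≃ₗ[F] (Fin n → F))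

/-- Invertible matrices as linear automorphisms of `F ^ n`. -/
noncomputable def glEquiv (F : Type*) [Field F] (n : ℕ) :
    GL (Fin n) F ≃* ((Fin n → F) ≃ₗ[F] (Fin n → F)) :=
  Matrix.GeneralLinearGroup.toLin.trans (LinearMap.GeneralLinearGroup.generalLinearEquiv F _)

theorem coe_glEquiv {n : ℕ} (g : GL (Fin n) F) :
    (glEquiv F n g : End F (Fin n → F)) = Matrix.toLin' (g : Matrix (Fin n) (Fin n) F) := by
  ext; rfl

theorem det_glEquiv {n : ℕ} (g : GL (Fin n) F) :
    LinearEquiv.det (glEquiv F n g) = Matrix.GeneralLinearGroup.det g := by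
  ext
  rw [LinearEquiv.coe_det, coe_glEquiv, LinearMap.det_toLin']
  rfl

variable [Finite F]

theorem card_linearEquiv_self_pos (V : Type*) [AddCommGroup V] [Module F V]
    [FiniteDimensional F V] : 0 < Nat.card (V ≃ₗ[F] V) := Nat.card_pos

omit [Finite F] in
theorem freeProportion_nonneg (P : F[X]) (n : ℕ) (δ : Fˣ) : 0 ≤ freeProportion P n δ := by
  unfold freeProportion; positivity

theorem freeProportion_le_one (P : F[X]) (n : ℕ) (δ : Fˣ) : freeProportion P n δ ≤ 1 := by
  unfold freeProportion freeCount
  rw [div_le_one (by exact_mod_cast card_linearEquiv_self_pos (Fin n → F))]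
  exact_mod_cast Nat.card_le_card_of_injective _ Subtype.val_injective

/-- The hypothesis `n ≠ 0` is necessary: the determinant is `1` on `GL(0, F)`. -/
theorem card_det_fiber {n : ℕ} (hn : n ≠ 0) (δ : Fˣ) :
    Nat.card {g : GL (Fin n) F // Matrix.GeneralLinearGroup.det g = δ} * Nat.card Fˣ =
      Nat.card (GL (Fin n) F) := by
  have : Nonempty (Fin n) := ⟨⟨0, Nat.pos_of_ne_zero hn⟩⟩
  have hs := Matrix.GeneralLinearGroup.det_surjective (n := Fin n) (R := F)
  have := Fintype.ofFinite Fˣ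
  rw [← Nat.card_congr (Equiv.sigmaFiberEquiv
    (Matrix.GeneralLinearGroup.det : GL (Fin n) F →* Fˣ)), Nat.card_sigma]
  have h : ∀ ε : Fˣ, Nat.card {g : GL (Fin n) F // Matrix.GeneralLinearGroup.det g = ε} =
      Nat.card {g : GL (Fin n) F // Matrix.GeneralLinearGroup.det g = δ} := by
    intro ε
    obtain ⟨x, hx⟩ := hs (δ * ε⁻¹)
    exact Nat.card_congr ((Equiv.mulLeft x).subtypeEquiv fun g => by
      rw [Equiv.coe_mulLeft, map_mul, hx, mul_assoc, mul_eq_left, inv_mul_eq_one, eq_comm])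
  rw [Finset.sum_congr rfl fun ε _ => h ε]
  simp [mul_comm]

theorem freeProportion_one {n : ℕ} (hn : n ≠ 0) (δ : Fˣ) :
    freeProportion (1 : F[X]) n δ = (Nat.card Fˣ : ℝ)⁻¹ := by
  have h1 : freeCount (Fin n → F) (1 : F[X]) δ =
      Nat.card {g : GL (Fin n) F // Matrix.GeneralLinearGroup.det g = δ} := by
    refine (Nat.card_congr ((glEquiv F n).toEquiv.subtypeEquiv fun g => ?_)).symm
    change _ ↔ LinearEquiv.det (glEquiv F n g) = δ ∧ _
    rw [det_glEquiv, map_one]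
    exact ⟨fun h => ⟨h, fun _ _ h => h⟩, fun h => h.1⟩
  have h2 : (0 : ℝ) < Nat.card (GL (Fin n) F) := by exact_mod_cast Nat.card_pos
  have h3 : (0 : ℝ) < Nat.card Fˣ := by exact_mod_cast Nat.card_pos
  rw [freeProportion, h1, ← Nat.card_congr (glEquiv F n).toEquiv, ← card_det_fiber hn δ,
    Nat.cast_mul]
  rw [← card_det_fiber hn δ, Nat.cast_mul] at h2
  have h4 := (pos_iff_pos_of_mul_pos h2).2 h3
  field_simp

theorem card_isAdapted_pairs_eq {W : Type*} [AddCommGroup W] [Module F W] [FiniteDimensional F W]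
    (P : F[X]) (δ : Fˣ) (C : W ≃ₗ[F] W) {n : ℕ} (hn : finrank F W ≤ n) :
    (Nat.card {p : {i : W →ₗ[F] (Fin n → F) // Function.Injective i} ×
      ((Fin n → F) ≃ₗ[F] (Fin n → F)) // IsAdapted P δ C p.1.1 p.2} : ℝ) =
      Nat.card ((Fin n → F) ≃ₗ[F] (Fin n → F)) *
        freeProportion P (n - finrank F W) (δ * (LinearEquiv.det C)⁻¹) := by
  have h := card_isAdapted_pairs (V := Fin n → F) (B := Fin (n - finrank F W) → F) P δ C
    (by simp; omega)
  have h2 : (0 : ℝ) < Nat.card ((Fin (n - finrank F W) → F) ≃ₗ[F] (Fin (n - finrank F W) → F)) := by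
    exact_mod_cast card_linearEquiv_self_pos _
  rw [freeProportion, mul_div_assoc', eq_div_iff h2.ne']
  exact_mod_cast h

/-- Multiplication by the root of `φ` on `(F[X]/(φ))^m`. -/
noncomputable def rootSMul (φ : F[X]) [Fact (Irreducible φ)] (h : AdjoinRoot.root φ ≠ 0) (m : ℕ) :
    (Fin m → AdjoinRoot φ) ≃ₗ[F] (Fin m → AdjoinRoot φ) :=
  (LinearEquiv.smulOfNeZero (AdjoinRoot φ) _ (AdjoinRoot.root φ) h).restrictScalars F

omit [Finite F] in
theorem injective_aeval_rootSMul {P φ : F[X]} [Fact (Irreducible φ)] (h : AdjoinRoot.root φ ≠ 0)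
    (hP : IsCoprime P φ) (m : ℕ) :
    Function.Injective (aeval (rootSMul φ h m : End F (Fin m → AdjoinRoot φ)) P) := by
  have h1 : (rootSMul φ h m : End F (Fin m → AdjoinRoot φ)) =
      Algebra.lsmul F F _ (AdjoinRoot.root φ) := by ext; rfl
  rw [h1, aeval_algHom_apply, AdjoinRoot.aeval_eq]
  have h2 : AdjoinRoot.mk φ P ≠ 0 := by
    intro h3
    rw [AdjoinRoot.mk_eq_zero] at h3
    exact (Fact.out : Irreducible φ).not_isUnit (hP.isUnit_of_dvd' h3 dvd_rfl)
  exact smul_right_injective _ h2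

/-- Among the `g` with `P(g)` injective, those with `φ(g)` injective are singled out by
`q`-binomial inversion over the dimension of `ker φ(g)`; the numbers of intertwining maps are then
summed over `g` by counting adapted pairs. The condition `dim ≤ n` matters because `n - dim` is
truncated. -/
theorem freeProportion_mul_eq {P φ : F[X]} [hφ : Fact (Irreducible φ)]
    (h : AdjoinRoot.root φ ≠ 0) (hP : IsCoprime P φ) (n : ℕ) (δ : Fˣ) :
    freeProportion (P * φ) n δ = ∑ m ∈ Finset.range (n + 1),
      invCoeff (Nat.card (AdjoinRoot φ)) m * if finrank F (Fin m → AdjoinRoot φ) ≤ n then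
        freeProportion P (n - finrank F (Fin m → AdjoinRoot φ))
          (δ * (LinearEquiv.det (rootSMul φ h m))⁻¹) else 0 := by
  classical
  have hfd : FiniteDimensional F (AdjoinRoot φ) := (AdjoinRoot.powerBasis hφ.out.ne_zero).finite
  have hfin : Finite (AdjoinRoot φ) := Module.finite_of_finite F
  have hQ : (1 : ℝ) < Nat.card (AdjoinRoot φ) := by exact_mod_cast Finite.one_lt_card
  have hGL : (0 : ℝ) < Nat.card ((Fin n → F) ≃ₗ[F] (Fin n → F)) := by
    exact_mod_cast card_linearEquiv_self_pos _
  set G := {g : (Fin n → F) ≃ₗ[F] (Fin n → F) // LinearEquiv.det g = δ ∧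
    Function.Injective (aeval (g : End F (Fin n → F)) P)} with hG
  have := Fintype.ofFinite G
  let N : ℕ → G → Type _ := fun m g => {i : (Fin m → AdjoinRoot φ) →ₗ[F] (Fin n → F) //
    Function.Injective i ∧ ∀ w, g.1 (i w) = i (AdjoinRoot.root φ • w)}
  have key : ∀ g : G, (if Function.Injective (aeval (g.1 : End F (Fin n → F)) φ) then (1 : ℝ)
      else 0) = ∑ m ∈ Finset.range (n + 1), invCoeff (Nat.card (AdjoinRoot φ)) m *
        Nat.card (N m g) := by
    intro g
    obtain ⟨k, hkn, hk, hN⟩ := exists_card_intertwining_eq φ (g.1 : End F (Fin n → F))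
    rw [finrank_fin_fun] at hkn
    simp only [← hk]
    rw [← sum_invCoeff_mul hQ hkn]
    exact Finset.sum_congr rfl fun m _ => by rw [← hN m]; rfl
  have h1 : (freeCount (Fin n → F) (P * φ) δ : ℝ) =
      ∑ g : G, if Function.Injective (aeval (g.1 : End F (Fin n → F)) φ) then (1 : ℝ) else 0 := by
    rw [Finset.sum_boole, ← Fintype.card_subtype, ← Nat.card_eq_fintype_card, freeCount]
    congr 1
    apply Nat.card_congr
    refine Equiv.trans ?_ (Equiv.subtypeSubtypeEquivSubtypeInter
      (fun g : (Fin n → F) ≃ₗ[F] (Fin n → F) => LinearEquiv.det g = δ ∧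
        Function.Injective (aeval (g : End F (Fin n → F)) P))
      (fun g => Function.Injective (aeval (g : End F (Fin n → F)) φ))).symm
    refine Equiv.subtypeEquivRight fun g => ?_
    rw [and_assoc]
    refine and_congr_right fun _ => ?_
    rw [map_mul]
    constructor
    · intro h
      have hc : aeval (g : End F (Fin n → F)) P * aeval (g : End F (Fin n → F)) φ =
        aeval (g : End F (Fin n → F)) φ * aeval (g : End F (Fin n → F)) P := by
          rw [← map_mul, mul_comm, map_mul]
      refine ⟨?_, Function.Injective.of_comp (f := aeval (g : End F (Fin n → F)) P) h⟩
      rw [hc] at h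
      exact Function.Injective.of_comp (f := aeval (g : End F (Fin n → F)) φ) h
    · rintro ⟨h, h'⟩
      exact h.comp h'
  have h2 : ∀ m, (∑ g : G, (Nat.card (N m g) : ℝ)) =
      Nat.card ((Fin n → F) ≃ₗ[F] (Fin n → F)) *
        if finrank F (Fin m → AdjoinRoot φ) ≤ n then
          freeProportion P (n - finrank F (Fin m → AdjoinRoot φ))
            (δ * (LinearEquiv.det (rootSMul φ h m))⁻¹) else 0 := by
    intro m
    split_ifs with hm
    · rw [← card_isAdapted_pairs_eq P δ (rootSMul φ h m) hm, ← Nat.cast_sum, ← Nat.card_sigma]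
      congr 1
      apply Nat.card_congr
      refine
        { toFun := fun x => ⟨(⟨x.2.1, x.2.2.1⟩, x.1.1), ?_⟩
          invFun := fun p => ⟨⟨p.1.2, ?_⟩, ⟨p.1.1.1, p.1.1.2, ?_⟩⟩
          left_inv := fun x => rfl
          right_inv := fun p => rfl }
      · exact (isAdapted_iff_of_injective x.2.2.1 (injective_aeval_rootSMul h hP m)).2
          ⟨x.2.2.2, x.1.2⟩
      · exact ((isAdapted_iff_of_injective p.1.1.2 (injective_aeval_rootSMul h hP m)).1 p.2).2
      · exact ((isAdapted_iff_of_injective p.1.1.2 (injective_aeval_rootSMul h hP m)).1 p.2).1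
    -- There is no injective map into a space of smaller dimension.
    · rw [mul_zero]
      refine Finset.sum_eq_zero fun g _ => ?_
      have : IsEmpty (N m g) := ⟨fun i => hm (by
        simpa using LinearMap.finrank_le_finrank_of_injective i.2.1)⟩
      simp
  rw [freeProportion, h1, div_eq_iff hGL.ne', Finset.sum_congr rfl fun g _ => key g,
    Finset.sum_comm, Finset.sum_mul]
  refine Finset.sum_congr rfl fun m _ => ?_
  rw [← Finset.mul_sum, h2]
  ring

/-- If the free proportions for `P` have a common limit over all determinants, then so do those
for `P * φ`. -/
theorem tendsto_freeProportion_mul {P φ : F[X]} [hφ : Fact (Irreducible φ)]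
    (h : AdjoinRoot.root φ ≠ 0) (hP : IsCoprime P φ) {c : ℝ}
    (hc : ∀ δ, Tendsto (fun n => freeProportion P n δ) atTop (𝓝 c)) (δ : Fˣ) :
    Tendsto (fun n => freeProportion (P * φ) n δ) atTop
      (𝓝 ((∑' m, invCoeff (Nat.card (AdjoinRoot φ)) m) * c)) := by
  have hfd : FiniteDimensional F (AdjoinRoot φ) := (AdjoinRoot.powerBasis hφ.out.ne_zero).finite
  have hfin : Finite (AdjoinRoot φ) := Module.finite_of_finite F
  have hQ : (2 : ℝ) ≤ Nat.card (AdjoinRoot φ) := by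
    exact_mod_cast Nat.succ_le_of_lt Finite.one_lt_card
  set t : ℕ → ℕ → ℝ := fun n m => if finrank F (Fin m → AdjoinRoot φ) ≤ n then
        freeProportion P (n - finrank F (Fin m → AdjoinRoot φ))
          (δ * (LinearEquiv.det (rootSMul φ h m))⁻¹) else 0 with ht
  have h1 : ∀ n, freeProportion (P * φ) n δ =
      ∑' m, invCoeff (Nat.card (AdjoinRoot φ)) m * t n m := by
    intro n
    rw [freeProportion_mul_eq h hP n δ, tsum_eq_sum]
    intro m hm
    have hd : 0 < finrank F (AdjoinRoot φ) := finrank_pos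
    have : ¬ finrank F (Fin m → AdjoinRoot φ) ≤ n := by
      rw [Finset.mem_range] at hm
      rw [Module.finrank_pi_fintype]
      simp only [Finset.sum_const, Finset.card_univ, Fintype.card_fin, smul_eq_mul]
      nlinarith
    simp only [ht, if_neg this, mul_zero]
  simp only [h1]
  rw [← tsum_mul_right]
  refine tendsto_tsum_of_dominated_convergence (summable_abs_invCoeff hQ) (fun m => ?_)
    (Eventually.of_forall fun n m => ?_)
  · refine Tendsto.const_mul _ ?_
    refine ((hc (δ * (LinearEquiv.det (rootSMul φ h m))⁻¹)).comp
      (tendsto_sub_atTop_nat (finrank F (Fin m → AdjoinRoot φ)))).congr' ?_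
    filter_upwards [eventually_ge_atTop (finrank F (Fin m → AdjoinRoot φ))] with n hn
    simp [ht, hn]
  · rw [Real.norm_eq_abs, abs_mul]
    refine mul_le_of_le_one_right (abs_nonneg _) ?_
    simp only [ht]
    split_ifs
    · rw [abs_of_nonneg (freeProportion_nonneg _ _ _)]
      exact freeProportion_le_one _ _ _
    · simp

/-- The polynomial `X` is excluded since the root of `φ` has to act invertibly; `X(g) = g` is
injective anyway. -/
theorem exists_tendsto_freeProportion_prod (S : Finset F[X])
    (hS : ∀ φ ∈ S, φ.Monic ∧ Irreducible φ ∧ φ ≠ X) :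
    ∃ c : ℝ, 0 < c ∧ ∀ δ, Tendsto (fun n => freeProportion (∏ φ ∈ S, φ) n δ) atTop (𝓝 c) := by
  classical
  induction S using Finset.induction_on with
  | empty =>
    refine ⟨(Nat.card Fˣ : ℝ)⁻¹, inv_pos.2 (by exact_mod_cast Nat.card_pos), fun δ => ?_⟩
    refine tendsto_const_nhds.congr' ?_
    filter_upwards [eventually_ne_atTop 0] with n hn
    rw [Finset.prod_empty, freeProportion_one hn]
  | insert φ S hφ ih =>
    obtain ⟨c, hc0, hc⟩ := ih fun ψ hψ => hS ψ (Finset.mem_insert_of_mem hψ)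
    obtain ⟨hmon, hirr, hX⟩ := hS φ (Finset.mem_insert_self _ _)
    have : Fact (Irreducible φ) := ⟨hirr⟩
    have hroot : AdjoinRoot.root φ ≠ 0 := by
      rw [← AdjoinRoot.mk_X, Ne, AdjoinRoot.mk_eq_zero]
      intro h
      exact hX (eq_of_monic_of_associated hmon monic_X
        (hirr.associated_of_dvd irreducible_X h))
    have hcop : IsCoprime (∏ ψ ∈ S, ψ) φ := by
      refine IsCoprime.prod_left fun ψ hψ => ?_
      obtain ⟨hmon', hirr', -⟩ := hS ψ (Finset.mem_insert_of_mem hψ)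
      refine hirr'.coprime_iff_not_dvd.2 fun h => ?_
      have := eq_of_monic_of_associated hmon' hmon (hirr'.associated_of_dvd hirr h)
      exact hφ (this ▸ hψ)
    have hfd : FiniteDimensional F (AdjoinRoot φ) := (AdjoinRoot.powerBasis hirr.ne_zero).finite
    have hfin : Finite (AdjoinRoot φ) := Module.finite_of_finite F
    have hQ : (2 : ℝ) ≤ Nat.card (AdjoinRoot φ) := by
      exact_mod_cast Nat.succ_le_of_lt Finite.one_lt_card
    refine ⟨_, mul_pos (tsum_invCoeff_pos hQ) hc0, fun δ => ?_⟩
    rw [Finset.prod_insert hφ, mul_comm]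
    exact tendsto_freeProportion_mul hroot hcop hc δ

end FreeProportion

/-! ### Decomposition by the primary part -/

section PrimaryPart

variable {F : Type*} [Field F]

theorem card_injective_range_eq {a : ℕ} {V : Type*} [AddCommGroup V] [Module F V]
    [FiniteDimensional F V] (K : Submodule F V) :
    Nat.card {i : (Fin a → F) →ₗ[F] V // Function.Injective i ∧ LinearMap.range i = K} =
      if finrank F K = a then Nat.card ((Fin a → F) ≃ₗ[F] (Fin a → F)) else 0 := by
  split_ifs with h
  · let e : (Fin a → F) ≃ₗ[F] K := LinearEquiv.ofFinrankEq _ _ (by simp [h])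
    refine (Nat.card_congr (Equiv.ofBijective (fun g : (Fin a → F) ≃ₗ[F] (Fin a → F) =>
      (⟨K.subtype ∘ₗ (g.trans e : (Fin a → F) →ₗ[F] K),
        K.subtype_injective.comp (g.trans e).injective, ?_⟩ :
        {i : (Fin a → F) →ₗ[F] V // Function.Injective i ∧ LinearMap.range i = K})) ⟨?_, ?_⟩)).symm
    · rw [LinearMap.range_comp, LinearEquiv.range, Submodule.map_subtype_top]
    · intro g g' hgg
      rw [Subtype.mk.injEq] at hgg
      ext1 v
      apply e.injective
      apply K.subtype_injective
      exact LinearMap.congr_fun hgg v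
    · rintro ⟨i, hi, hK⟩
      refine ⟨((LinearEquiv.ofInjective i hi).trans (LinearEquiv.ofEq _ _ hK)).trans e.symm, ?_⟩
      apply Subtype.ext
      refine LinearMap.ext fun v => ?_
      simp
  · have : IsEmpty {i : (Fin a → F) →ₗ[F] V // Function.Injective i ∧ LinearMap.range i = K} :=
      ⟨fun i => h (by rw [← i.2.2, LinearMap.finrank_range_of_inj i.2.1, finrank_fin_fun])⟩
    simp

theorem exists_linearEquiv_restricting {V W : Type*} [AddCommGroup V] [Module F V]
    [AddCommGroup W] [Module F W] [FiniteDimensional F W] {i : W →ₗ[F] V}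
    (hi : Function.Injective i) (g : V ≃ₗ[F] V)
    (hg : ∀ w, g (i w) ∈ LinearMap.range i) : ∃ C : W ≃ₗ[F] W, ∀ w, g (i w) = i (C w) := by
  let e := LinearEquiv.ofInjective i hi
  let c : W →ₗ[F] W := (e.symm : LinearMap.range i →ₗ[F] W) ∘ₗ
    ((g : V →ₗ[F] V) ∘ₗ i).codRestrict (LinearMap.range i) hg
  have hc : ∀ w, i (c w) = g (i w) := fun w =>
    congrArg Subtype.val (e.apply_symm_apply ⟨g (i w), hg w⟩)
  have hinj : Function.Injective c := fun x y hxy => hi (g.injective (by rw [← hc, ← hc, hxy]))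
  exact ⟨LinearEquiv.ofInjectiveEndo c hinj, fun w => (hc w).symm⟩

/-- A property of automorphisms of the spaces `F ^ n` is determined by the `P`-primary part when
it holds for `g` if and only if it holds for the restriction of `g` to the generalized kernel of
`P(g)`, transported to some `F ^ a`. -/
def DependsOnPrimaryPart (P : F[X]) (D : ∀ n : ℕ, ((Fin n → F) ≃ₗ[F] (Fin n → F)) → Prop) : Prop :=
  ∀ (n a : ℕ) (g : (Fin n → F) ≃ₗ[F] (Fin n → F)) (C : (Fin a → F) ≃ₗ[F] (Fin a → F))
    (i : (Fin a → F) →ₗ[F] (Fin n → F)), Function.Injective i → (∀ w, g (i w) = i (C w)) →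
    LinearMap.range i = LinearMap.ker (aeval (g : End F (Fin n → F)) P ^ n) → (D n g ↔ D a C)

/-- The elements `C` of `GL(a, F)` with property `D` such that `P(C)` is nilpotent. -/
abbrev PrimaryElement (P : F[X]) (D : ∀ n : ℕ, ((Fin n → F) ≃ₗ[F] (Fin n → F)) → Prop) (a : ℕ) :=
  {C : (Fin a → F) ≃ₗ[F] (Fin a → F) // IsNilpotent (aeval (C : End F (Fin a → F)) P) ∧ D a C}

variable {P : F[X]} {D : ∀ n : ℕ, ((Fin n → F) ≃ₗ[F] (Fin n → F)) → Prop}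

/-- An automorphism `g` together with a parametrization `i` of its `P`-primary part by `F ^ a`
determines the automorphism `C` of `F ^ a` that corresponds to the primary part, and `(i, g)` is
adapted to `C`. -/
theorem bijective_primaryElement_pairs (hD : DependsOnPrimaryPart P D) (n a : ℕ) (δ : Fˣ) :
    ∃ f : (Σ C : PrimaryElement P D a,
        {p : {i : (Fin a → F) →ₗ[F] (Fin n → F) // Function.Injective i} ×
          ((Fin n → F) ≃ₗ[F] (Fin n → F)) // IsAdapted P δ C.1 p.1.1 p.2}) →
      (Σ g : {g : (Fin n → F) ≃ₗ[F] (Fin n → F) // LinearEquiv.det g = δ ∧ D n g},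
        {i : (Fin a → F) →ₗ[F] (Fin n → F) // Function.Injective i ∧
          LinearMap.range i = LinearMap.ker (aeval (g.1 : End F (Fin n → F)) P ^ n)}),
      Function.Bijective f := by
  have had : ∀ (C : PrimaryElement P D a) (i : (Fin a → F) →ₗ[F] (Fin n → F)) g,
      IsAdapted P δ C.1 i g ↔ (∀ w, g (i w) = i (C.1 w)) ∧ LinearEquiv.det g = δ ∧
        LinearMap.range i = LinearMap.ker (aeval (g : End F (Fin n → F)) P ^ n) := by
    intro C i g
    rw [isAdapted_iff_of_isNilpotent C.2.1, finrank_fin_fun]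
  refine ⟨fun x => ⟨⟨x.2.1.2, ((had _ _ _).1 x.2.2).2.1, ?_⟩,
    ⟨x.2.1.1.1, x.2.1.1.2, ((had _ _ _).1 x.2.2).2.2⟩⟩, ?_, ?_⟩
  · exact (hD n a _ _ _ x.2.1.1.2 ((had _ _ _).1 x.2.2).1 ((had _ _ _).1 x.2.2).2.2).2 x.1.2.2
  · rintro ⟨⟨C, hC⟩, ⟨⟨⟨i, hi⟩, g⟩, h⟩⟩ ⟨⟨C', hC'⟩, ⟨⟨⟨i', hi'⟩, g'⟩, h'⟩⟩ hxy
    simp only [Sigma.mk.injEq, Subtype.mk.injEq] at hxy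
    obtain ⟨rfl, hi2⟩ := hxy
    rw [heq_eq_eq, Subtype.mk.injEq] at hi2
    subst hi2
    have : C = C' := by
      ext1 w
      apply hi
      rw [← h.1, ← h'.1]
    subst this
    rfl
  · rintro ⟨⟨g, hg, hgD⟩, ⟨i, hi, hr⟩⟩
    have hcomm : ∀ v, g ((aeval (g : End F (Fin n → F)) P ^ n) v) =
        (aeval (g : End F (Fin n → F)) P ^ n) (g v) := fun v => by
      rw [← map_pow]
      exact aeval_apply_of_semiconj (f := (g : End F (Fin n → F))) (fun _ => rfl) (P ^ n) v
    obtain ⟨C, hC⟩ := exists_linearEquiv_restricting hi g fun w => by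
      have : i w ∈ LinearMap.ker (aeval (g : End F (Fin n → F)) P ^ n) := hr ▸ ⟨w, rfl⟩
      rw [LinearMap.mem_ker] at this
      rw [hr, LinearMap.mem_ker, ← hcomm, this, map_zero]
    have hnil : IsNilpotent (aeval (C : End F (Fin a → F)) P) := by
      refine ⟨n, LinearMap.ext fun w => ?_⟩
      apply hi
      rw [← map_pow, aeval_apply_of_semiconj (f := i) (fun w => (hC w).symm) (P ^ n) w, map_pow]
      have : i w ∈ LinearMap.ker (aeval (g : End F (Fin n → F)) P ^ n) := hr ▸ ⟨w, rfl⟩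
      rw [LinearMap.mem_ker] at this
      rw [this]; simp
    refine ⟨⟨⟨C, hnil, (hD n a g C i hi hC hr).1 hgD⟩, ⟨(⟨i, hi⟩, g), ?_⟩⟩, rfl⟩
    exact (had ⟨C, hnil, (hD n a g C i hi hC hr).1 hgD⟩ i g).2 ⟨hC, hg, hr⟩

variable [Finite F]

/-- The proportion of `g ∈ GL(n, F)` with property `D` and determinant `δ`, sorted by the
`P`-primary part. The denominator `|GL(a, F)|` accounts for the choice of a basis of that part. -/
theorem proportion_eq_sum_primaryElement (hD : DependsOnPrimaryPart P D) (n : ℕ) (δ : Fˣ) :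
    (Nat.card {g : (Fin n → F) ≃ₗ[F] (Fin n → F) // LinearEquiv.det g = δ ∧ D n g} : ℝ) /
      Nat.card ((Fin n → F) ≃ₗ[F] (Fin n → F)) =
    ∑ a ∈ Finset.range (n + 1), (∑ᶠ C : PrimaryElement P D a,
      freeProportion P (n - a) (δ * (LinearEquiv.det C.1)⁻¹)) /
        Nat.card ((Fin a → F) ≃ₗ[F] (Fin a → F)) := by
  classical
  set G := {g : (Fin n → F) ≃ₗ[F] (Fin n → F) // LinearEquiv.det g = δ ∧ D n g} with hG
  have := Fintype.ofFinite G
  have hpos : ∀ m, (0 : ℝ) < Nat.card ((Fin m → F) ≃ₗ[F] (Fin m → F)) := fun m => by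
    exact_mod_cast card_linearEquiv_self_pos _
  let d : G → ℕ := fun g => finrank F (LinearMap.ker (aeval (g.1 : End F (Fin n → F)) P ^ n))
  have h1 : ∀ a ∈ Finset.range (n + 1), Nat.card ((Fin n → F) ≃ₗ[F] (Fin n → F)) *
      ((∑ᶠ C : PrimaryElement P D a, freeProportion P (n - a) (δ * (LinearEquiv.det C.1)⁻¹)) /
        Nat.card ((Fin a → F) ≃ₗ[F] (Fin a → F))) = ∑ g : G, if d g = a then (1 : ℝ) else 0 := by
    intro a ha
    have := Fintype.ofFinite (PrimaryElement P D a)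
    obtain ⟨f, hf⟩ := bijective_primaryElement_pairs hD n a δ
    have h2 := Nat.card_congr (Equiv.ofBijective f hf)
    rw [Nat.card_sigma, Nat.card_sigma] at h2
    have h3 : finrank F (Fin a → F) ≤ n := by
      rw [finrank_fin_fun]; exact Nat.lt_succ_iff.1 (Finset.mem_range.1 ha)
    have h4 := congrArg (Nat.cast : ℕ → ℝ) h2
    rw [Nat.cast_sum, Nat.cast_sum,
      Finset.sum_congr rfl fun C _ => card_isAdapted_pairs_eq P δ C.1 h3,
      ← Finset.mul_sum, finrank_fin_fun,
      Finset.sum_congr rfl fun g _ => congrArg Nat.cast (card_injective_range_eq _)] at h4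
    rw [finsum_eq_sum_of_fintype, mul_div_assoc', h4, div_eq_iff (hpos a).ne', Finset.sum_mul]
    refine Finset.sum_congr rfl fun g _ => ?_
    simp only [d]
    split_ifs <;> simp
  rw [div_eq_iff (hpos n).ne', mul_comm, Finset.mul_sum, Finset.sum_congr rfl h1, Finset.sum_comm]
  have h5 : ∀ g : G, (∑ a ∈ Finset.range (n + 1), if d g = a then (1 : ℝ) else 0) = 1 := by
    intro g
    have : d g ∈ Finset.range (n + 1) := by
      rw [Finset.mem_range, Nat.lt_succ_iff]
      exact (Submodule.finrank_le _).trans_eq (finrank_fin_fun F)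
    rw [Finset.sum_ite_eq, if_pos this]
  rw [Finset.sum_congr rfl fun g _ => h5 g]
  simp [hG, Nat.card_eq_fintype_card]

/-- The contribution of the `g` with a primary part of dimension `a`, and `0` if `a > n`, where
`n - a` is truncated. -/
noncomputable def primaryTerm (P : F[X]) (D : ∀ n : ℕ, ((Fin n → F) ≃ₗ[F] (Fin n → F)) → Prop)
    (δ : Fˣ) (n a : ℕ) : ℝ :=
  if a ≤ n then (∑ᶠ C : PrimaryElement P D a,
      freeProportion P (n - a) (δ * (LinearEquiv.det C.1)⁻¹)) /
        Nat.card ((Fin a → F) ≃ₗ[F] (Fin a → F)) else 0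

omit [Finite F] in
theorem primaryTerm_nonneg (δ : Fˣ) (n a : ℕ) : 0 ≤ primaryTerm P D δ n a := by
  unfold primaryTerm
  split_ifs
  · exact div_nonneg (finsum_nonneg fun C => freeProportion_nonneg _ _ _) (Nat.cast_nonneg _)
  · exact le_rfl

theorem primaryTerm_le (δ : Fˣ) (n a : ℕ) :
    primaryTerm P D δ n a ≤ (Nat.card (PrimaryElement P (fun _ _ => True) a) : ℝ) /
      Nat.card ((Fin a → F) ≃ₗ[F] (Fin a → F)) := by
  unfold primaryTerm
  have := Fintype.ofFinite (PrimaryElement P D a)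
  split_ifs
  · gcongr
    rw [finsum_eq_sum_of_fintype]
    calc _ ≤ ∑ C : PrimaryElement P D a, (1 : ℝ) :=
          Finset.sum_le_sum fun C _ => freeProportion_le_one _ _ _
      _ = Nat.card (PrimaryElement P D a) := by simp [Nat.card_eq_fintype_card]
      _ ≤ _ := by
        exact_mod_cast Nat.card_le_card_of_injective
          (fun C : PrimaryElement P D a => (⟨C.1, C.2.1, trivial⟩ :
            PrimaryElement P (fun _ _ => True) a))
          fun C C' h => Subtype.ext (congrArg (fun C => C.1) h)
  · positivity

theorem tendsto_primaryTerm {c : ℝ}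
    (hc : ∀ δ, Tendsto (fun n => freeProportion P n δ) atTop (𝓝 c)) (δ : Fˣ) (a : ℕ) :
    Tendsto (fun n => primaryTerm P D δ n a) atTop
      (𝓝 (Nat.card (PrimaryElement P D a) * c / Nat.card ((Fin a → F) ≃ₗ[F] (Fin a → F)))) := by
  have := Fintype.ofFinite (PrimaryElement P D a)
  have h1 : Tendsto (fun n => (∑ C : PrimaryElement P D a,
      freeProportion P (n - a) (δ * (LinearEquiv.det C.1)⁻¹)) /
        Nat.card ((Fin a → F) ≃ₗ[F] (Fin a → F))) atTop
      (𝓝 (Nat.card (PrimaryElement P D a) * c / Nat.card ((Fin a → F) ≃ₗ[F] (Fin a → F)))) := by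
    refine Tendsto.div_const ?_ _
    have h2 : (Nat.card (PrimaryElement P D a) * c : ℝ) = ∑ C : PrimaryElement P D a, c := by
      simp [Nat.card_eq_fintype_card]
    rw [h2]
    exact tendsto_finsetSum _ fun C _ => (hc _).comp (tendsto_sub_atTop_nat a)
  refine h1.congr' ?_
  filter_upwards [eventually_ge_atTop a] with n hn
  rw [primaryTerm, if_pos hn, finsum_eq_sum_of_fintype]

theorem proportion_eq_sum_primaryTerm (hD : DependsOnPrimaryPart P D) (n : ℕ) (δ : Fˣ) :
    (Nat.card {g : (Fin n → F) ≃ₗ[F] (Fin n → F) // LinearEquiv.det g = δ ∧ D n g} : ℝ) /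
      Nat.card ((Fin n → F) ≃ₗ[F] (Fin n → F)) =
    ∑ a ∈ Finset.range (n + 1), primaryTerm P D δ n a := by
  rw [proportion_eq_sum_primaryElement hD]
  refine Finset.sum_congr rfl fun a ha => ?_
  rw [primaryTerm, if_pos (Nat.lt_succ_iff.1 (Finset.mem_range.1 ha))]

/-- Since the proportions of all elements with a given primary part add up to at most `1`, a
positive limit of the proportions with trivial primary part forces summability. -/
theorem summable_card_primaryElement_div {c : ℝ} (hc0 : 0 < c)
    (hc : ∀ δ, Tendsto (fun n => freeProportion P n δ) atTop (𝓝 c)) :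
    Summable fun a : ℕ => (Nat.card (PrimaryElement P (fun _ _ => True) a) : ℝ) /
      Nat.card ((Fin a → F) ≃ₗ[F] (Fin a → F)) := by
  refine summable_of_sum_range_le (c := c⁻¹) (fun a => by positivity) fun N => ?_
  have h1 : Tendsto (fun n => ∑ a ∈ Finset.range N, primaryTerm P (fun _ _ => True) 1 n a) atTop
      (𝓝 (∑ a ∈ Finset.range N, Nat.card (PrimaryElement P (fun _ _ => True) a) * c /
        Nat.card ((Fin a → F) ≃ₗ[F] (Fin a → F)))) :=
    tendsto_finsetSum _ fun a _ => tendsto_primaryTerm hc 1 a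
  have h2 : ∀ᶠ n in atTop, ∑ a ∈ Finset.range N, primaryTerm P (fun _ _ => True) 1 n a ≤ 1 := by
    filter_upwards [eventually_ge_atTop N] with n hn
    calc _ ≤ ∑ a ∈ Finset.range (n + 1), primaryTerm P (fun _ _ => True) 1 n a :=
          Finset.sum_le_sum_of_subset_of_nonneg (Finset.range_subset_range.2 (by omega))
            fun a _ _ => primaryTerm_nonneg _ _ _
      _ ≤ 1 := by
        rw [← proportion_eq_sum_primaryTerm (fun _ _ _ _ _ _ _ _ => Iff.rfl),
          div_le_one (by exact_mod_cast card_linearEquiv_self_pos (Fin n → F))]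
        exact_mod_cast Nat.card_le_card_of_injective _ Subtype.val_injective
  have h3 := le_of_tendsto h1 h2
  rw [← mul_one (c⁻¹), ← div_eq_inv_mul, le_div_iff₀ hc0, Finset.sum_mul]
  refine le_trans (le_of_eq (Finset.sum_congr rfl fun a _ => ?_)) h3
  ring

/-- A property that depends only on the primary part has, among the elements of determinant `δ`, a
limiting proportion that does not depend on `δ`. -/
theorem exists_tendsto_proportion {c : ℝ} (hc0 : 0 < c)
    (hc : ∀ δ, Tendsto (fun n => freeProportion P n δ) atTop (𝓝 c))
    (hD : DependsOnPrimaryPart P D) :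
    ∃ l : ℝ, ∀ δ : Fˣ, Tendsto (fun n =>
      (Nat.card {g : (Fin n → F) ≃ₗ[F] (Fin n → F) // LinearEquiv.det g = δ ∧ D n g} : ℝ) /
        Nat.card ((Fin n → F) ≃ₗ[F] (Fin n → F))) atTop (𝓝 l) := by
  refine ⟨∑' a : ℕ, Nat.card (PrimaryElement P D a) * c /
    Nat.card ((Fin a → F) ≃ₗ[F] (Fin a → F)), fun δ => ?_⟩
  have h1 : ∀ n, ∑ a ∈ Finset.range (n + 1), primaryTerm P D δ n a =
      ∑' a, primaryTerm P D δ n a := fun n => by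
    rw [tsum_eq_sum]
    intro a ha
    rw [Finset.mem_range] at ha
    rw [primaryTerm, if_neg (by omega)]
  simp only [proportion_eq_sum_primaryTerm hD, h1]
  refine tendsto_tsum_of_dominated_convergence (summable_card_primaryElement_div hc0 hc)
    (fun a => tendsto_primaryTerm hc δ a) (Eventually.of_forall fun n a => ?_)
  rw [Real.norm_eq_abs, abs_of_nonneg (primaryTerm_nonneg _ _ _)]
  exact primaryTerm_le _ _ _

end PrimaryPart

/-! ### Invariant subspaces and the primary part of low degree -/

section LowDegree

variable {F : Type*} [Field F] [Finite F]

theorem finite_setOf_natDegree_le (k : ℕ) : {p : F[X] | p.natDegree ≤ k}.Finite := by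
  have h1 : Finite (degreeLT F (k + 1)) := Finite.of_equiv _ (degreeLTEquiv F (k + 1)).symm.toEquiv
  refine (Set.toFinite (degreeLT F (k + 1) : Set F[X])).subset fun p hp => ?_
  rw [SetLike.mem_coe, mem_degreeLT]
  exact lt_of_le_of_lt (natDegree_le_iff_degree_le.1 hp) (by exact_mod_cast Nat.lt_succ_self k)

/-- The monic irreducible polynomials of degree at most `k`, other than `X`. -/
noncomputable def lowIrreducibles (F : Type*) [Field F] [Finite F] (k : ℕ) : Finset F[X] :=
  ((finite_setOf_natDegree_le (F := F) k).subset
    (fun _ hp => hp.2 : {p : F[X] | (p.Monic ∧ Irreducible p ∧ p ≠ X) ∧ p.natDegree ≤ k} ⊆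
      {p : F[X] | p.natDegree ≤ k})).toFinset

theorem mem_lowIrreducibles {k : ℕ} {p : F[X]} :
    p ∈ lowIrreducibles F k ↔ (p.Monic ∧ Irreducible p ∧ p ≠ X) ∧ p.natDegree ≤ k := by
  simp [lowIrreducibles]

open UniqueFactorizationMonoid in
theorem exists_dvd_pow_prod_lowIrreducibles {k : ℕ} {χ : F[X]} (h0 : χ ≠ 0)
    (hk : χ.natDegree ≤ k) : ∃ N : ℕ, χ ∣ (X * ∏ φ ∈ lowIrreducibles F k, φ) ^ N := by
  classical
  refine ⟨Multiset.card (normalizedFactors χ), ?_⟩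
  rw [← (prod_normalizedFactors h0).dvd_iff_dvd_left, ← Multiset.prod_replicate,
    ← Multiset.map_const']
  nth_rw 1 [← Multiset.map_id (normalizedFactors χ)]
  refine Multiset.prod_dvd_prod_of_dvd _ _ fun φ hφ => ?_
  have hirr := irreducible_of_normalized_factor φ hφ
  have hmon : φ.Monic := by
    have := normalize_normalized_factor φ hφ
    rw [← this]
    exact monic_normalize hirr.ne_zero
  by_cases hX : φ = X
  · simp [hX]
  · have : φ ∈ lowIrreducibles F k := mem_lowIrreducibles.2
      ⟨⟨hmon, hirr, hX⟩, (natDegree_le_of_dvd (dvd_of_mem_normalizedFactors hφ) h0).trans hk⟩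
    exact (Finset.dvd_prod_of_mem _ this).mul_left _

/-- An invariant subspace of dimension `k` lies in the primary part for the irreducible
polynomials of degree at most `k`: its characteristic polynomial has degree `k`. -/
theorem le_ker_pow_of_map_eq {V : Type*} [AddCommGroup V] [Module F V] [FiniteDimensional F V]
    (g : V ≃ₗ[F] V) {W : Submodule F V} (hW : W.map (g : End F V) = W) :
    W ≤ LinearMap.ker (aeval (g : End F V)
      (∏ φ ∈ lowIrreducibles F (finrank F W), φ) ^ finrank F V) := by
  set P := ∏ φ ∈ lowIrreducibles F (finrank F W), φ with hP
  have hmem : ∀ w ∈ W, (g : End F V) w ∈ W := fun w hw => by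
    rw [← hW]; exact Submodule.mem_map_of_mem hw
  let r : End F W := (g : End F V).restrict hmem
  have hr : ∀ (Q : F[X]) (w : W), ((aeval r Q w : W) : V) = aeval (g : End F V) Q w :=
    fun Q w => aeval_apply_of_semiconj (f := W.subtype) (fun _ => rfl) Q w
  obtain ⟨N, Q, hQ⟩ := exists_dvd_pow_prod_lowIrreducibles (F := F) (k := finrank F W)
    (LinearMap.charpoly_monic r).ne_zero (LinearMap.charpoly_natDegree r).le
  have h1 : aeval r ((X * P) ^ N) = 0 := by
    rw [hQ, map_mul, LinearMap.aeval_self_charpoly, zero_mul]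
  intro w hw
  apply Module.End.ker_pow_le_ker_pow_finrank _ N
  have h2 := hr ((X * P) ^ N) ⟨w, hw⟩
  rw [h1, mul_pow, map_mul, map_pow, aeval_X, Module.End.mul_apply] at h2
  -- The factor `X ^ N` evaluates to `g ^ N`, which is injective and can be removed.
  have h3 : Function.Injective ((g : End F V) ^ N) := by
    rw [Module.End.coe_pow]
    exact g.injective.iterate N
  rw [LinearMap.mem_ker, ← map_pow]
  exact h3 (h2.symm.trans (map_zero _).symm)

/-- The automorphism `g` of `F ^ n` fixes no `k`-dimensional subspace: the condition on matrices
in `IsDerangementOnKSpaces`, for linear automorphisms. -/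
def FixesNoSubspace (F : Type*) [Field F] (k : ℕ) (n : ℕ) (g : (Fin n → F) ≃ₗ[F] (Fin n → F)) :
    Prop :=
  ∀ W : Submodule F (Fin n → F), finrank F W = k → W.map (g : End F (Fin n → F)) ≠ W

/-- The invariant `k`-spaces of `g` are the images of those of its primary part. -/
theorem dependsOnPrimaryPart_fixesNoSubspace (k : ℕ) :
    DependsOnPrimaryPart (∏ φ ∈ lowIrreducibles F k, φ) (FixesNoSubspace F k) := by
  intro n a g C i hi hgC hrange
  have hmap : ∀ W' : Submodule F (Fin a → F), (W'.map i).map (g : End F (Fin n → F)) =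
      (W'.map (C : End F (Fin a → F))).map i := fun W' => by
    rw [← Submodule.map_comp, ← Submodule.map_comp]
    congr 1
    exact LinearMap.ext hgC
  have hfin : ∀ W' : Submodule F (Fin a → F), finrank F (W'.map i) = finrank F W' := fun W' =>
    (Submodule.equivMapOfInjective i hi W').finrank_eq.symm
  constructor
  · intro h W' hk hW'
    exact h (W'.map i) ((hfin W').trans hk) (by rw [hmap, hW'])
  · intro h W hk hW
    have hle : W ≤ LinearMap.range i := by
      have := le_ker_pow_of_map_eq g hW
      rwa [hk, finrank_fin_fun, ← hrange] at this
    have hc : (W.comap i).map i = W := by rw [Submodule.map_comap_eq, inf_eq_right.2 hle]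
    refine h (W.comap i) (by rw [← hfin, hc, hk]) (Submodule.map_injective_of_injective hi ?_)
    rw [← hmap, hc, hW]

omit [Finite F] in
theorem isDerangementOnKSpaces_iff {k n : ℕ} (g : GL (Fin n) F) :
    IsDerangementOnKSpaces k g ↔ FixesNoSubspace F k n (glEquiv F n g) := by
  rw [IsDerangementOnKSpaces, FixesNoSubspace, coe_glEquiv]

/-- The proportion of derangements of determinant `δ` has a limit independent of `δ`. -/
theorem exists_tendsto_card_derangements_det (F : Type*) [Field F] [Finite F] (k : ℕ) :
    ∃ l : ℝ, ∀ δ : Fˣ, Tendsto (fun n => (Nat.card {g : GL (Fin n) F //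
      Matrix.GeneralLinearGroup.det g = δ ∧ IsDerangementOnKSpaces k g} : ℝ) /
        Nat.card (GL (Fin n) F)) atTop (𝓝 l) := by
  obtain ⟨c, hc0, hc⟩ := exists_tendsto_freeProportion_prod (lowIrreducibles F k)
    fun φ hφ => (mem_lowIrreducibles.1 hφ).1
  obtain ⟨l, hl⟩ := exists_tendsto_proportion hc0 hc (dependsOnPrimaryPart_fixesNoSubspace k)
  refine ⟨l, fun δ => (hl δ).congr fun n => ?_⟩
  rw [Nat.card_congr (glEquiv F n).toEquiv]
  congr 2
  refine (Nat.card_congr ((glEquiv F n).toEquiv.subtypeEquiv fun g => ?_)).symm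
  rw [isDerangementOnKSpaces_iff, ← det_glEquiv]
  rfl

omit [Finite F] in
theorem mem_smul_slSubgroup_iff {n : ℕ} (g h : GL (Fin n) F) :
    h ∈ g • (slSubgroup n F : Set (GL (Fin n) F)) ↔
      Matrix.GeneralLinearGroup.det h = Matrix.GeneralLinearGroup.det g := by
  have h1 : ∀ x : GL (Fin n) F, x ∈ slSubgroup n F ↔ Matrix.GeneralLinearGroup.det x = 1 := by
    intro x
    constructor
    · rintro ⟨s, rfl⟩
      exact Matrix.SpecialLinearGroup.coeToGL_det s
    · intro hx
      exact ⟨⟨x, congrArg Units.val hx⟩, Units.ext rfl⟩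
  rw [Set.mem_smul_set_iff_inv_smul_mem, SetLike.mem_coe, h1, smul_eq_mul, map_mul, map_inv,
    inv_mul_eq_one, eq_comm]

theorem derangementProportion_univ (k n : ℕ) :
    derangementProportion k (Set.univ : Set (GL (Fin n) F)) = ∑ᶠ δ : Fˣ,
      (Nat.card {g : GL (Fin n) F // Matrix.GeneralLinearGroup.det g = δ ∧
        IsDerangementOnKSpaces k g} : ℝ) / Nat.card (GL (Fin n) F) := by
  have := Fintype.ofFinite Fˣ
  rw [derangementProportion, finsum_eq_sum_of_fintype, ← Finset.sum_div, Set.ncard_univ,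
    ← Nat.cast_sum, ← Nat.card_sigma, ← Nat.card_coe_set_eq]
  congr 2
  exact Nat.card_congr
    { toFun := fun h => ⟨Matrix.GeneralLinearGroup.det h.1, h.1, rfl, h.2.2⟩
      invFun := fun x => ⟨x.2.1, trivial, x.2.2.2⟩
      left_inv := fun h => rfl
      right_inv := by rintro ⟨_, g, rfl, h⟩; rfl }

theorem derangementProportion_coset (k : ℕ) {n : ℕ} (hn : n ≠ 0) (g : GL (Fin n) F) :
    derangementProportion k (g • (slSubgroup n F : Set (GL (Fin n) F))) =
      Nat.card Fˣ * ((Nat.card {h : GL (Fin n) F // Matrix.GeneralLinearGroup.det h =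
        Matrix.GeneralLinearGroup.det g ∧ IsDerangementOnKSpaces k h} : ℝ) /
          Nat.card (GL (Fin n) F)) := by
  rw [derangementProportion, ← card_det_fiber hn (Matrix.GeneralLinearGroup.det g),
    ← Nat.card_coe_set_eq, ← Nat.card_coe_set_eq]
  have h1 : Nat.card {h ∈ g • (slSubgroup n F : Set (GL (Fin n) F)) |
      IsDerangementOnKSpaces k h} = Nat.card {h : GL (Fin n) F //
        Matrix.GeneralLinearGroup.det h = Matrix.GeneralLinearGroup.det g ∧
          IsDerangementOnKSpaces k h} :=
    Nat.card_congr (Equiv.subtypeEquivRight fun h => by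
      rw [Set.mem_ofPred_eq, mem_smul_slSubgroup_iff])
  have h2 : Nat.card (g • (slSubgroup n F : Set (GL (Fin n) F)) : Set (GL (Fin n) F)) =
      Nat.card {h : GL (Fin n) F // Matrix.GeneralLinearGroup.det h =
        Matrix.GeneralLinearGroup.det g} :=
    Nat.card_congr (Equiv.subtypeEquivRight fun h => mem_smul_slSubgroup_iff g h)
  have h3 : (0 : ℝ) < Nat.card Fˣ := by exact_mod_cast Nat.card_pos
  rw [h1, h2, Nat.cast_mul]
  field_simp

end LowDegree

/-! ### The limits -/

theorem mainTheorem7 {F : Type*} [Field F] [Finite F] (k : ℕ) (hk : 1 ≤ k) :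
    ∃ L : ℝ,
      Tendsto (fun n : ℕ => derangementProportion k (Set.univ : Set (GL (Fin n) F)))
        atTop (𝓝 L) ∧
      ∀ g : (n : ℕ) → GL (Fin n) F,
        Tendsto
          (fun n : ℕ => derangementProportion k
            (g n • (slSubgroup n F : Set (GL (Fin n) F))))
          atTop (𝓝 L) := by
  have := Fintype.ofFinite Fˣ
  obtain ⟨l, hl⟩ := exists_tendsto_card_derangements_det F k
  refine ⟨Nat.card Fˣ * l, ?_, fun g => ?_⟩
  · simp only [derangementProportion_univ, finsum_eq_sum_of_fintype]
    have h1 : (Nat.card Fˣ * l : ℝ) = ∑ δ : Fˣ, l := by simp [Nat.card_eq_fintype_card]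
    rw [h1]
    exact tendsto_finsetSum _ fun δ _ => hl δ
  · have h1 : Tendsto (fun n => (Nat.card {h : GL (Fin n) F // Matrix.GeneralLinearGroup.det h =
        Matrix.GeneralLinearGroup.det (g n) ∧ IsDerangementOnKSpaces k h} : ℝ) /
          Nat.card (GL (Fin n) F)) atTop (𝓝 l) := by
      -- The determinants `det (g n)` vary with `n`, but they take finitely many values.
      rw [tendsto_nhds]
      intro s hs hls
      have h2 := eventually_all.2 fun δ => (hl δ).eventually (hs.mem_nhds hls)
      exact h2.mono fun n hn => hn _
    refine (h1.const_mul (Nat.card Fˣ : ℝ)).congr' ?_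
    filter_upwards [eventually_ne_atTop 0] with n hn
    rw [derangementProportion_coset k hn]
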